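/- A *partial spread* of a $2n$-dimensional vector space is a set of $n$-dimensional subspaces any two of which meet only in $0$. In a symplectic (respectively orthogonal) space it is a *symplectic* (respectively *orthogonal*) partial spread if its members are totally isotropic (respectively totally singular); an orthogonal partial spread is an *orthogonal spread* if every singular vector lies in one of its members. "Maximal" means maximal with respect to inclusion among the partial spreads of the named kind. An $\mathrm{Sp}(2n,q)$-space is a $2n$-dimensional $\mathbb F_q$-space with a nondegenerate alternating bilinear form; an $\mathrm O^+(2n,q)$-space is a $2n$-dimensional $\mathbb F_q$-space with a quadratic form whose polar form is nondegenerate and which has a totally singular $n$-dimensional subspace. **Theorem.** Let $q$ be a power of $2$, and let $k\ge 1$ and $m$ be integers with $m>(k+1)/2$. (a) Every $\mathrm{Sp}(4mk-2,q)$-space has a maximal symplectic partial spread of size $q^{2mk-k}+1$. (b) Such partial spreads are obtained by projection, as follows. Let $(V,Q)$ be an $\mathrm O^+(4m,q^k)$-space, let $T\colon\mathbb F_{q^k}\to\mathbb F_q$ be the trace map, and let $Q'(v)=T(Q(v))$. Then $(V,Q)$ has an orthogonal spread, and $(V,Q')$ is an $\mathrm O^+(4mk,q)$-space. If $\Sigma$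 is any orthogonal spread of $(V,Q)$ then, over $\mathbb F_q$, $\Sigma$ is an orthogonal partial spread of $(V,Q')$ that is maximal among all partial spreads of the $\mathbb F_q$-space $V$, and $|\Sigma|=q^{2mk-k}+1$. Moreover, for every nonsingular point $z$ of $(V,Q')$ (a $1$-dimensional $\mathbb F_q$-subspace on which $Q'$ is not zero), the quotient $z^\perp/z$, with $\perp$ and the induced form taken with respect to the polar form of $Q'$, is an $\mathrm{Sp}(4mk-2,q)$-space, and $$\Sigma/z=\{\langle z^\perp\cap X,\,z\rangle/z \;:\; X\in\Sigma\}$$ is a maximal symplectic partial spread of $z^\perp/z$ of size $q^{2mk-k}+1$. -/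

import Mathlib

namespace PartialSpread

open Module

section Forms

variable {K V : Type*} [Field K] [AddCommGroup V] [Module K V]

/-- A subspace is totally isotropic for a bilinear form `B` if `B` vanishes on it. -/
def IsTotallyIsotropic (B : LinearMap.BilinForm K V) (X : Submodule K V) : Prop :=
  ∀ x ∈ X, ∀ y ∈ X, B x y = 0

/-- A subspace is totally singular for a quadratic form `Q` if `Q` vanishes on it. -/
def IsTotallySingular (Q : QuadraticForm K V) (X : Submodule K V) : Prop :=
  ∀ x ∈ X, Q x = 0

/-- `(V, B)` is a symplectic space of dimension `d`: `B` is a nondegenerate alternating form. -/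
structure IsSymplecticSpace (B : LinearMap.BilinForm K V) (d : ℕ) : Prop where
  finite : Module.Finite K V
  finrank_eq : finrank K V = d
  isAlt : B.IsAlt
  nondegenerate : B.Nondegenerate

/-- `(V, Q)` is an orthogonal space of plus type and dimension `2 n`: the polar form of `Q` is
nondegenerate and there is a totally singular subspace of dimension `n` (Witt index `n`). -/
structure IsOrthogonalPlusSpace (Q : QuadraticForm K V) (n : ℕ) : Prop where
  finite : Module.Finite K V
  finrank_eq : finrank K V = 2 * n
  nondegenerate : Q.polarBilin.Nondegenerate
  exists_singular : ∃ U : Submodule K V, IsTotallySingular Q U ∧ finrank K U = n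

end Forms

section Spreads

variable (K V : Type*) [Field K] [AddCommGroup V] [Module K V]

/-- A partial spread of a `2 n`-dimensional space `V`: a set of `n`-dimensional subspaces,
any two of which meet only in `0`. -/
structure IsPartialSpread (S : Set (Submodule K V)) : Prop where
  half_dim : ∀ X ∈ S, 2 * finrank K X = finrank K V
  inf_eq_bot : ∀ X ∈ S, ∀ Y ∈ S, X ≠ Y → X ⊓ Y = ⊥

variable {K V}

/-- A partial spread consisting of totally isotropic subspaces. -/
def IsSymplecticPartialSpread (B : LinearMap.BilinForm K V) (S : Set (Submodule K V)) : Prop :=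
  IsPartialSpread K V S ∧ ∀ X ∈ S, IsTotallyIsotropic B X

/-- A partial spread consisting of totally singular subspaces. -/
def IsOrthogonalPartialSpread (Q : QuadraticForm K V) (S : Set (Submodule K V)) : Prop :=
  IsPartialSpread K V S ∧ ∀ X ∈ S, IsTotallySingular Q X

/-- An orthogonal partial spread whose members cover all singular vectors. -/
def IsOrthogonalSpread (Q : QuadraticForm K V) (S : Set (Submodule K V)) : Prop :=
  IsOrthogonalPartialSpread Q S ∧ ∀ v : V, Q v = 0 → ∃ X ∈ S, v ∈ X

end Spreads

section Projection

variable {K V : Type*} [Field K] [AddCommGroup V] [Module K V]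

/-- The hyperplane `z^⊥` of all vectors perpendicular to `z` for the polar form of `Q`. -/
def perp (Q : QuadraticForm K V) (z : V) : Submodule K V :=
  LinearMap.ker (Q.polarBilin z)

/-- The line spanned by `z`, as a subspace of `z^⊥` (in characteristic two, `z ∈ z^⊥`). -/
def lineInPerp (Q : QuadraticForm K V) (z : V) : Submodule K (perp Q z) :=
  (Submodule.span K {z}).comap (perp Q z).subtype

/-- The quotient space `z^⊥ / z`. -/
abbrev PerpQuotient (Q : QuadraticForm K V) (z : V) : Type _ :=
  perp Q z ⧸ lineInPerp Q z

/-- The restriction to `z^⊥` of the polar form of `Q`. -/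
def perpForm (Q : QuadraticForm K V) (z : V) : LinearMap.BilinForm K (perp Q z) :=
  Q.polarBilin.domRestrict₁₂ (perp Q z) (perp Q z)

theorem perpForm_line (Q : QuadraticForm K V) (z : V) (x y : perp Q z)
    (hx : x ∈ lineInPerp Q z) : perpForm Q z x y = 0 := by
  obtain ⟨c, hc⟩ := Submodule.mem_span_singleton.mp hx
  have hy : Q.polarBilin z y = 0 := y.2
  change Q.polarBilin (x : V) (y : V) = 0
  have hc' : c • z = (x : V) := hc
  rw [← hc', map_smul, LinearMap.smul_apply, hy, smul_zero]

theorem perpForm_symm (Q : QuadraticForm K V) (z : V) (x y : perp Q z) :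
    perpForm Q z x y = perpForm Q z y x :=
  QuadraticMap.polar_comm Q x y

/-- The bilinear form induced on `z^⊥ / z` by the polar form of `Q`. -/
def quotientForm (Q : QuadraticForm K V) (z : V) :
    LinearMap.BilinForm K (PerpQuotient Q z) :=
  (lineInPerp Q z).liftQ
    ((lineInPerp Q z).liftQ (perpForm Q z)
      (fun x hx => LinearMap.ext fun y => perpForm_line Q z x y hx)).flip
    (fun x hx => LinearMap.ext fun w => by
      obtain ⟨y, rfl⟩ := (lineInPerp Q z).mkQ_surjective w
      exact (perpForm_symm Q z y x).trans (perpForm_line Q z x y hx))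

theorem quotientForm_mk (Q : QuadraticForm K V) (z : V) (x y : perp Q z) :
    quotientForm Q z ((lineInPerp Q z).mkQ x) ((lineInPerp Q z).mkQ y)
      = QuadraticMap.polar Q (x : V) (y : V) :=
  perpForm_symm Q z y x

/-- The projection `⟨z^⊥ ∩ X, z⟩ / z` of a subspace `X` into `z^⊥ / z`. -/
def projectSubspace (Q : QuadraticForm K V) (z : V) (X : Submodule K V) :
    Submodule K (PerpQuotient Q z) :=
  (((perp Q z ⊓ X) ⊔ Submodule.span K {z}).comap (perp Q z).subtype).map (lineInPerp Q z).mkQ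

end Projection

section Trace

variable (E : Type*) {F V : Type*} [Field E] [Field F] [Algebra E F]
  [AddCommGroup V] [Module F V] [Module E V] [IsScalarTower E F V]

/-- The quadratic form `v ↦ Tr(Q(v))` over the subfield `E`, with `Tr` the trace of `F / E`. -/
noncomputable def traceForm (Q : QuadraticForm F V) : QuadraticForm E V :=
  (Algebra.trace E F).compQuadraticMap' Q

theorem traceForm_apply (Q : QuadraticForm F V) (v : V) :
    traceForm E Q v = Algebra.trace E F (Q v) := rfl

/-- A set of `F`-subspaces of `V`, viewed as a set of `E`-subspaces. -/
def restrictSpread (S : Set (Submodule F V)) : Set (Submodule E V) :=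
  (fun X => X.restrictScalars E) '' S

end Trace

end PartialSpread

namespace PartialSpread

open Module

/-! ### Totally singular subspaces of half dimension and hyperbolic coordinates -/

section LinearAlgebra

variable {K V : Type*} [Field K] [AddCommGroup V] [Module K V]

/-! Let $F/E$ have degree $k$ with $|E|=q$. Everything rests on one fact: an $E$-subspace $Y$ of $V$
with $\dim_E Y>2k$ contains a nonzero vector that is singular for $Q$ itself, not merely for the
trace form. Indeed, in an $E$-basis of $F$ the equation $Q(y)=0$ becomes $k$ quadratic equations
over $E$, and Chevalley–Warning applies (`exists_singular_of_two_mul_finrank_lt`). An orthogonal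
spread of $(V,Q)$ covers that vector, so some member meets $Y$ nontrivially. A further member of a
partial spread would have $E$-dimension $2mk$, which exceeds $2k$ because $m\ge 2$; hence maximality
over $E$.

For the projection, squaring is bijective on a finite field of characteristic $2$, and
$Q'(v+cz)=Q'(v)+c^2Q'(z)$ on $z^\perp$. Each coset of the line $\langle z\rangle$ in $z^\perp$
therefore contains exactly one singular vector, so a totally isotropic $Y$ in $z^\perp/z$ lifts to a
totally singular subspace of the same dimension (`finrank_singularLift`). For half-dimensional $Y$
this is $2mk-1>2k$, and the same fact applies.

Orthogonal spreads exist by the Kerdock construction: the space is hyperbolic, and the graphs of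
$|F|^{2m-1}$ alternating maps with nonsingular differences, together with one further subspace,
cover all singular vectors by counting. Part (a) follows from (b) on a model space, since symplectic
spaces of equal dimension are isometric (`IsSymplecticSpace.exists_isometry`). -/

theorem natCard_fiber_of_ne_zero [Finite K] [Module.Finite K V] (φ : V →ₗ[K] K) (hφ : φ ≠ 0)
    (c : K) : Nat.card {u : V // φ u = c} = Nat.card K ^ (finrank K V - 1) := by
  obtain ⟨u₀, hu₀⟩ := LinearMap.surjective hφ c
  have e : {u : V // φ u = c} ≃ LinearMap.ker φ :=
    { toFun := fun u => ⟨u.1 - u₀, by simp [u.2, hu₀]⟩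
      invFun := fun w => ⟨w.1 + u₀, by simp [hu₀]⟩
      left_inv := fun u => by simp
      right_inv := fun w => by simp }
  rw [Nat.card_congr e, Module.natCard_eq_pow_finrank (K := K),
    ← Module.Dual.finrank_ker_add_one_of_ne_zero (f := φ) hφ, Nat.add_sub_cancel]

theorem IsTotallySingular.polar_eq_zero {Q : QuadraticForm K V} {U : Submodule K V}
    (hU : IsTotallySingular Q U) {x y : V} (hx : x ∈ U) (hy : y ∈ U) :
    QuadraticMap.polar Q x y = 0 := by
  simp [QuadraticMap.polar, hU _ (U.add_mem hx hy), hU _ hx, hU _ hy]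

/-- A totally singular $U$ lies in $U^\perp$, and both have dimension $n$, so $U=U^\perp$. -/
theorem IsOrthogonalPlusSpace.mem_of_polar_eq_zero {Q : QuadraticForm K V} {n : ℕ}
    (hQ : IsOrthogonalPlusSpace Q n) {U : Submodule K V} (hU : IsTotallySingular Q U)
    (hn : finrank K U = n) {v : V} (hv : ∀ u ∈ U, QuadraticMap.polar Q v u = 0) : v ∈ U := by
  have := hQ.finite
  have hle : U ≤ LinearMap.BilinForm.orthogonal Q.polarBilin U := fun x hx y hy => hU.polar_eq_zero hy hx
  have hf := LinearMap.BilinForm.finrank_orthogonal hQ.nondegenerate U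
  rw [hQ.finrank_eq, hn] at hf
  rw [Submodule.eq_of_le_of_finrank_eq hle (by omega)]
  intro u hu
  rw [QuadraticMap.polarBilin_apply_apply,
    QuadraticMap.polar_comm]
  exact hv u hu

/-- Restriction to `U` of the functionals given by the polar form. -/
def polarRestrict (Q : QuadraticForm K V) (U : Submodule K V) : V →ₗ[K] Dual K U :=
  U.subtype.dualMap ∘ₗ Q.polarBilin

theorem polarRestrict_apply (Q : QuadraticForm K V) (U : Submodule K V) (v : V) (u : U) :
    polarRestrict Q U v u = QuadraticMap.polar Q v u := rfl

theorem IsOrthogonalPlusSpace.ker_polarRestrict {Q : QuadraticForm K V} {n : ℕ}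
    (hQ : IsOrthogonalPlusSpace Q n) {U : Submodule K V} (hU : IsTotallySingular Q U)
    (hn : finrank K U = n) : LinearMap.ker (polarRestrict Q U) = U := by
  ext v
  refine ⟨fun hv => hQ.mem_of_polar_eq_zero hU hn fun u hu => ?_, fun hv => ?_⟩
  · exact LinearMap.congr_fun (LinearMap.mem_ker.mp hv) ⟨u, hu⟩
  · exact LinearMap.ext fun u => hU.polar_eq_zero hv u.2

theorem IsOrthogonalPlusSpace.polarRestrict_surjective {Q : QuadraticForm K V} {n : ℕ}
    (hQ : IsOrthogonalPlusSpace Q n) {U : Submodule K V} (hU : IsTotallySingular Q U)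
    (hn : finrank K U = n) : Function.Surjective (polarRestrict Q U) := by
  have := hQ.finite
  rw [← LinearMap.range_eq_top]
  apply Submodule.eq_top_of_finrank_eq
  have h := LinearMap.finrank_range_add_finrank_ker (polarRestrict Q U)
  rw [hQ.ker_polarRestrict hU hn, hn, hQ.finrank_eq] at h
  rw [Subspace.dual_finrank_eq, hn]
  omega

/-- An orthogonal space of plus type is hyperbolic. -/
theorem IsOrthogonalPlusSpace.exists_equiv_dualProd {Q : QuadraticForm K V} {n : ℕ}
    (hQ : IsOrthogonalPlusSpace Q n) (M : Type*) [AddCommGroup M] [Module K M]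
    [Module.Finite K M] (hM : finrank K M = n) :
    ∃ e : (Dual K M × M) ≃ₗ[K] V, ∀ x, Q (e x) = QuadraticForm.dualProd K M x := by
  have := hQ.finite
  obtain ⟨U, hU, hn⟩ := hQ.exists_singular
  obtain ⟨σ, hσ⟩ := (polarRestrict Q U).exists_rightInverse_of_surjective
    (LinearMap.range_eq_top.mpr (hQ.polarRestrict_surjective hU hn))
  -- The section `σ` need not have singular image. A bilinear `β`, not necessarily symmetric, with
  -- $\beta(f,f)=Q(\sigma f)$ exists in every characteristic. Moving $\sigma f$ by the vector of `U`
  -- representing $\beta(f,\cdot)$ subtracts exactly $\beta(f,f)$ from $Q$ and leaves the pairing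
  -- with `U` unchanged.
  obtain ⟨β, hβ⟩ := LinearMap.BilinMap.toQuadraticMap_surjective (Q.comp σ)
  let ρ : Dual K U →ₗ[K] U := (evalEquiv K U).symm.toLinearMap ∘ₗ β
  let τ : Dual K U →ₗ[K] V := σ - U.subtype ∘ₗ ρ
  have hσ' (f : Dual K U) : polarRestrict Q U (σ f) = f := LinearMap.congr_fun hσ f
  have hUker (u : U) : polarRestrict Q U u = 0 :=
    LinearMap.ext fun w => hU.polar_eq_zero u.2 w.2
  have hτ (f : Dual K U) : polarRestrict Q U (τ f) = f := by
    have : τ f = σ f - (ρ f : V) := rfl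
    rw [this, map_sub, hUker, hσ', sub_zero]
  have hρ (f g : Dual K U) : g (ρ f) = β f g := by
    have := apply_evalEquiv_symm_apply (R := K) (M := U) g (β f)
    exact this
  have hQτ (f : Dual K U) : Q (τ f) = 0 := by
    have h1 : τ f = σ f + -(ρ f : V) := sub_eq_add_neg _ _
    have h2 : Q (σ f) = β f f := by
      have := DFunLike.congr_fun hβ f
      exact this.symm
    have h3 : QuadraticMap.polar Q (σ f) (ρ f) = f (ρ f) := by
      rw [← polarRestrict_apply, hσ']
    rw [h1, QuadraticMap.map_add Q, QuadraticMap.polar_neg_right, QuadraticMap.map_neg,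
      hU _ (ρ f).2, h2, h3, hρ]
    ring
  let g : (Dual K (Dual K U) × Dual K U) →ₗ[K] V :=
    (U.subtype ∘ₗ (evalEquiv K U).symm.toLinearMap).coprod τ
  have hg (x) : g x = ((evalEquiv K U).symm x.1 : V) + τ x.2 := rfl
  have hQg (x) : Q (g x) = QuadraticForm.dualProd K (Dual K U) x := by
    rw [hg, QuadraticMap.map_add Q, hU _ (Subtype.mem _), hQτ, QuadraticMap.polar_comm,
      ← polarRestrict_apply, hτ, QuadraticForm.dualProd_apply, apply_evalEquiv_symm_apply,
      zero_add, zero_add]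
  have hinj : Function.Injective g := by
    rw [← LinearMap.ker_eq_bot, LinearMap.ker_eq_bot']
    intro x hx
    have h0 := congrArg (polarRestrict Q U) hx
    rw [hg, map_add, hUker, hτ, map_zero, zero_add] at h0
    rw [hg, h0, map_zero, add_zero, Submodule.coe_eq_zero, LinearEquiv.map_eq_zero_iff] at hx
    exact Prod.ext hx h0
  have hdim : finrank K (Dual K (Dual K U) × Dual K U) = finrank K V := by
    rw [finrank_prod, Subspace.dual_finrank_eq, Subspace.dual_finrank_eq, hQ.finrank_eq, hn]
    ring
  let e₁ : M ≃ₗ[K] Dual K U :=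
    LinearEquiv.ofFinrankEq _ _ (by rw [Subspace.dual_finrank_eq, hM, hn])
  refine ⟨(QuadraticForm.dualProdIsometry e₁).toLinearEquiv.trans
    (LinearEquiv.ofInjectiveOfFinrankEq g hinj hdim), fun x => ?_⟩
  exact (hQg _).trans ((QuadraticForm.dualProdIsometry e₁).map_app x)

end LinearAlgebra

/-! ### Transport of spreads along isometries -/

section Transport

variable {K V V' : Type*} [Field K] [AddCommGroup V] [Module K V] [AddCommGroup V'] [Module K V']

theorem IsPartialSpread.map {S : Set (Submodule K V)} (hS : IsPartialSpread K V S)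
    (e : V ≃ₗ[K] V') :
    IsPartialSpread K V' (Submodule.map (e : V →ₗ[K] V') '' S) := by
  refine ⟨?_, ?_⟩
  · rintro _ ⟨X, hX, rfl⟩
    rw [LinearEquiv.finrank_map_eq, hS.half_dim X hX, e.finrank_eq]
  · rintro _ ⟨X, hX, rfl⟩ _ ⟨Y, hY, rfl⟩ hne
    rw [← Submodule.map_inf _ e.injective, hS.inf_eq_bot X hX Y hY (fun h => hne (by rw [h])),
      Submodule.map_bot]

theorem IsOrthogonalSpread.map {Q : QuadraticForm K V} {Q' : QuadraticForm K V'}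
    {S : Set (Submodule K V)} (hS : IsOrthogonalSpread Q S) (e : V ≃ₗ[K] V')
    (he : ∀ x, Q' (e x) = Q x) :
    IsOrthogonalSpread Q' (Submodule.map (e : V →ₗ[K] V') '' S) := by
  refine ⟨⟨hS.1.1.map e, ?_⟩, fun v hv => ?_⟩
  · rintro _ ⟨X, hX, rfl⟩ _ ⟨x, hx, rfl⟩
    exact (he x).trans (hS.1.2 X hX x hx)
  · obtain ⟨X, hX, hvX⟩ := hS.2 (e.symm v) (by rw [← he, e.apply_symm_apply, hv])
    exact ⟨_, ⟨X, hX, rfl⟩, e.symm v, hvX, e.apply_symm_apply v⟩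

theorem IsSymplecticPartialSpread.map {B : LinearMap.BilinForm K V}
    {B' : LinearMap.BilinForm K V'} {S : Set (Submodule K V)}
    (hS : IsSymplecticPartialSpread B S) (e : V ≃ₗ[K] V')
    (he : ∀ x y, B' (e x) (e y) = B x y) :
    IsSymplecticPartialSpread B' (Submodule.map (e : V →ₗ[K] V') '' S) := by
  refine ⟨hS.1.map e, ?_⟩
  rintro _ ⟨X, hX, rfl⟩ _ ⟨x, hx, rfl⟩ _ ⟨y, hy, rfl⟩
  exact (he x y).trans (hS.2 X hX x hx y hy)

theorem maximal_isSymplecticPartialSpread_map {B : LinearMap.BilinForm K V}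
    {B' : LinearMap.BilinForm K V'} {S : Set (Submodule K V)}
    (hS : Maximal (IsSymplecticPartialSpread B) S) (e : V ≃ₗ[K] V')
    (he : ∀ x y, B' (e x) (e y) = B x y) :
    Maximal (IsSymplecticPartialSpread B') (Submodule.map (e : V →ₗ[K] V') '' S) := by
  refine ⟨hS.1.map e he, fun T hT hST Y hY => ?_⟩
  have hT' := hT.map e.symm (B' := B) fun x y => by
    rw [← he, e.apply_symm_apply, e.apply_symm_apply]
  have hcomp (X : Submodule K V) : (X.map (e : V →ₗ[K] V')).map (e.symm : V' →ₗ[K] V) = X := by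
    rw [← Submodule.map_comp]
    simp
  have hcomp' (X : Submodule K V') : (X.map (e.symm : V' →ₗ[K] V)).map (e : V →ₗ[K] V') = X := by
    rw [← Submodule.map_comp]
    simp
  have hle := hS.2 hT' fun X hX => ⟨_, hST ⟨X, hX, rfl⟩, hcomp X⟩
  exact ⟨_, hle ⟨Y, hY, rfl⟩, hcomp' Y⟩

theorem ncard_image_map_equiv (S : Set (Submodule K V)) (e : V ≃ₗ[K] V') :
    (Submodule.map (e : V →ₗ[K] V') '' S).ncard = S.ncard :=
  Set.ncard_image_of_injective _ (Submodule.map_injective_of_injective e.injective)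

end Transport

/-! ### The size of an orthogonal spread -/

section Counting

variable {K V : Type*} [Field K] [Finite K] [AddCommGroup V] [Module K V]

/-- An orthogonal spread of an `O⁺(2n, q)`-space has `q ^ (n - 1) + 1` members: each singular
vector of a fixed nonzero coset of one member lies in exactly one other member. -/
theorem IsOrthogonalSpread.ncard_eq {Q : QuadraticForm K V} {n : ℕ} (hn : n ≠ 0)
    (hQ : IsOrthogonalPlusSpace Q n) {S : Set (Submodule K V)} (hS : IsOrthogonalSpread Q S) :
    S.ncard = Nat.card K ^ (n - 1) + 1 := by
  have := hQ.finite
  have : Finite V := Module.finite_of_finite K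
  obtain ⟨X₀, hX₀, -⟩ := hS.2 0 (QuadraticMap.map_zero Q)
  have hdim (X) (hX : X ∈ S) : finrank K X = n := by
    have := hS.1.1.half_dim X hX
    rw [hQ.finrank_eq] at this
    omega
  obtain ⟨v, hv⟩ : ∃ v, v ∉ X₀ := by
    by_contra! h
    have h1 := hdim X₀ hX₀
    rw [(Submodule.eq_top_iff'.mpr h), finrank_top, hQ.finrank_eq] at h1
    omega
  have hφ : polarRestrict Q X₀ v ≠ 0 := fun h0 =>
    hv (hQ.ker_polarRestrict (hS.1.2 X₀ hX₀) (hdim X₀ hX₀) ▸ LinearMap.mem_ker.mpr h0)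
  -- On the coset $v+X_0$ the form $Q$ is affine, so its singular vectors form a fibre of a nonzero
  -- functional on $X_0$, of size $q^{n-1}$.
  have hsing (u : X₀) : Q (v + u) = 0 ↔ polarRestrict Q X₀ v u = - Q v := by
    rw [QuadraticMap.map_add Q, hS.1.2 X₀ hX₀ _ u.2, add_zero, polarRestrict_apply, add_comm,
      eq_neg_iff_add_eq_zero]
  have hne (u : X₀) (X : Submodule K V) (h : v + u ∈ X) : X ≠ X₀ := by
    rintro rfl
    exact hv ((Submodule.add_mem_iff_left _ u.2).mp h)
  choose f hfS hf using fun u : {u : X₀ // polarRestrict Q X₀ v u = - Q v} =>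
    hS.2 (v + u.1) ((hsing u.1).mpr u.2)
  let g (u : {u : X₀ // polarRestrict Q X₀ v u = - Q v}) : ↥(S \ {X₀}) :=
    ⟨f u, hfS u, hne u.1 _ (hf u)⟩
  have hg : Function.Bijective g := by
    refine ⟨fun u w huw => ?_, fun X => ?_⟩
    · have huw' : f u = f w := congrArg Subtype.val huw
      have hu := hf u
      rw [huw'] at hu
      have hsub : ((u.1 : V) - w.1) ∈ f w ⊓ X₀ := by
        refine ⟨?_, X₀.sub_mem u.1.2 w.1.2⟩
        have := (f w).sub_mem hu (hf w)
        rwa [add_sub_add_left_eq_sub] at this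
      rw [hS.1.1.inf_eq_bot _ (hfS w) _ hX₀ (hne w.1 _ (hf w)), Submodule.mem_bot,
        sub_eq_zero] at hsub
      exact Subtype.ext (Subtype.ext hsub)
    · obtain ⟨X, hX, hXne⟩ := X
      have hinf := hS.1.1.inf_eq_bot X hX X₀ hX₀ hXne
      -- Since $V=X\oplus X_0$, the component of `v` in `X` is a vector of $X\cap(v+X_0)$; this
      -- gives surjectivity.
      have hsup : X ⊔ X₀ = ⊤ := by
        apply Submodule.eq_top_of_finrank_eq
        have := Submodule.finrank_sup_add_finrank_inf_eq X X₀
        rw [hinf, finrank_bot, hdim X hX, hdim X₀ hX₀] at this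
        rw [hQ.finrank_eq]
        omega
      obtain ⟨x, hx, y, hy, hxy⟩ := Submodule.mem_sup.mp (hsup ▸ Submodule.mem_top : v ∈ X ⊔ X₀)
      have hvx : v + ((-⟨y, hy⟩ : X₀) : V) = x := by
        rw [← hxy]
        simp
      have hu : polarRestrict Q X₀ v (-⟨y, hy⟩) = - Q v := by
        rw [← hsing, hvx]
        exact hS.1.2 X hX x hx
      refine ⟨⟨-⟨y, hy⟩, hu⟩, Subtype.ext ?_⟩
      by_contra hne'
      have hmem : x ∈ f ⟨-⟨y, hy⟩, hu⟩ ⊓ X := ⟨hvx ▸ hf ⟨-⟨y, hy⟩, hu⟩, hx⟩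
      rw [hS.1.1.inf_eq_bot _ (hfS _) X hX hne', Submodule.mem_bot] at hmem
      rw [hmem, zero_add] at hxy
      exact hv (hxy ▸ hy)
  rw [← Set.ncard_sdiff_singleton_add_one hX₀, ← Nat.card_coe_set_eq,
    ← Nat.card_congr (Equiv.ofBijective g hg), natCard_fiber_of_ne_zero _ hφ, hdim X₀ hX₀]

end Counting

/-! ### From Kerdock sets to orthogonal spreads -/

section Kerdock

variable {K M : Type*} [Field K] [Finite K] [AddCommGroup M] [Module K M] [Module.Finite K M]

/-- A set of `q ^ (n - 1)` alternating forms with nonsingular differences yields an orthogonal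
spread of the hyperbolic space of dimension `2 n`. -/
theorem exists_isOrthogonalSpread_dualProd {ι : Type*} [Finite ι] (A : ι → M →ₗ[K] Dual K M)
    (halt : ∀ s v, A s v v = 0) (hinj : ∀ s t v, A s v = A t v → v ≠ 0 → s = t)
    (hcard : Nat.card ι = Nat.card K ^ (finrank K M - 1)) :
    ∃ S, IsOrthogonalSpread (QuadraticForm.dualProd K M) S := by
  let X : ι → Submodule K (Dual K M × M) := fun s => LinearMap.range ((A s).prod LinearMap.id)
  let Y : Submodule K (Dual K M × M) := LinearMap.range (LinearMap.inl K (Dual K M) M)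
  have hX (s) : finrank K (X s) = finrank K M :=
    LinearMap.finrank_range_of_inj fun v w h => congrArg Prod.snd h
  have hY : finrank K Y = finrank K M :=
    (LinearMap.finrank_range_of_inj LinearMap.inl_injective).trans Subspace.dual_finrank_eq
  have hdim : finrank K (Dual K M × M) = 2 * finrank K M := by
    rw [finrank_prod, Subspace.dual_finrank_eq, two_mul]
  have hXY (s) : X s ⊓ Y = ⊥ := by
    rw [eq_bot_iff]
    rintro _ ⟨⟨v, rfl⟩, ⟨f, hf⟩⟩
    have hv : (0 : M) = v := congrArg Prod.snd hf
    simp [← hv]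
  refine ⟨insert Y (Set.range X), ⟨⟨?_, ?_⟩, ?_⟩, ?_⟩
  · rintro _ (rfl | ⟨s, rfl⟩)
    · rw [hY, hdim]
    · rw [hX, hdim]
  · rintro _ (rfl | ⟨s, rfl⟩) _ (rfl | ⟨t, rfl⟩) hne
    · exact absurd rfl hne
    · rw [inf_comm, hXY]
    · exact hXY s
    · rw [eq_bot_iff]
      rintro _ ⟨⟨v, rfl⟩, ⟨w, hw⟩⟩
      obtain rfl : w = v := congrArg Prod.snd hw
      have h1 : A t w = A s w := congrArg Prod.fst hw
      by_cases hw0 : w = 0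
      · simp [hw0]
      · exact absurd (congrArg X (hinj s t w h1.symm hw0)) hne
  · rintro _ (rfl | ⟨s, rfl⟩) _ ⟨v, rfl⟩
    · simp
    · simpa using halt s v
  · rintro ⟨f, v⟩ hfv
    by_cases hv : v = 0
    · exact ⟨Y, Set.mem_insert _ _, f, by simp [hv]⟩
    · let φ : Dual K M →ₗ[K] K := Dual.eval K M v
      have hφ : φ ≠ 0 := fun h => hv ((Module.eval_apply_eq_zero_iff K v).mp h)
      -- A vector $(f,v)$ is singular iff $f(v)=0$. There are as many such `f` as indices `s`, so
      -- the injection $s\mapsto A_s v$ hits all of them.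
      have hc := natCard_fiber_of_ne_zero φ hφ 0
      rw [Subspace.dual_finrank_eq, ← hcard] at hc
      have : Finite (Dual K M) := Module.finite_of_finite K
      let g : ι → {u : Dual K M // φ u = 0} := fun s => ⟨A s v, halt s v⟩
      have hg : Function.Injective g := fun s t h => hinj s t v (congrArg Subtype.val h) hv
      obtain ⟨s, hs⟩ := (hg.bijective_of_nat_card_le hc.le).2 ⟨f, hfv⟩
      refine ⟨X s, Set.mem_insert_of_mem _ ⟨s, rfl⟩, v, ?_⟩
      exact Prod.ext (congrArg Subtype.val hs) rfl

end Kerdock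

/-! ### A Kerdock set over a field extension of odd degree -/

section KerdockField

variable {K L : Type*} [Field K] [Field L] [Algebra K L]

/-- The standard Kerdock set of alternating forms on `K × L`. -/
noncomputable def kerdockForm (s : L) : (K × L) →ₗ[K] Dual K (K × L) :=
  LinearMap.mk₂ K
    (fun u w => w.1 * Algebra.trace K L (s * u.2) + Algebra.trace K L
      (w.2 * (s ^ 2 * u.2 + s * algebraMap K L (Algebra.trace K L (s * u.2)) + u.1 • s)))
    (fun u u' w => by
      simp only [Prod.fst_add, Prod.snd_add, mul_add, add_smul, map_add]
      ring)
    (fun c u w => by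
      have : w.2 * (s ^ 2 * (c • u).2 + s * algebraMap K L (Algebra.trace K L (s * (c • u).2)) +
          (c • u).1 • s) = c • (w.2 * (s ^ 2 * u.2 +
            s * algebraMap K L (Algebra.trace K L (s * u.2)) + u.1 • s)) := by
        simp only [Prod.smul_fst, Prod.smul_snd, mul_smul_comm, map_smul, smul_eq_mul]
        simp only [Algebra.smul_def, map_mul (algebraMap K L)]
        ring
      rw [this, map_smul]
      simp only [Prod.smul_snd, mul_smul_comm, map_smul, smul_eq_mul]
      ring)
    (fun u w w' => by
      simp only [Prod.fst_add, Prod.snd_add, add_mul, map_add]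
      ring)
    (fun c u w => by
      simp only [Prod.smul_fst, Prod.smul_snd, smul_mul_assoc, map_smul, smul_eq_mul]
      ring)

theorem kerdockForm_apply (s : L) (u w : K × L) :
    kerdockForm s u w = w.1 * Algebra.trace K L (s * u.2) + Algebra.trace K L
      (w.2 * (s ^ 2 * u.2 + s * algebraMap K L (Algebra.trace K L (s * u.2)) + u.1 • s)) := rfl

/-- The trace is a sum of Frobenius conjugates, and squaring is additive and commutes with
Frobenius. -/
theorem trace_sq_of_charTwo [Finite K] [Finite L] [CharP K 2] (x : L) :
    Algebra.trace K L (x ^ 2) = Algebra.trace K L x ^ 2 := by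
  have : CharP L 2 := charP_of_injective_algebraMap (algebraMap K L).injective 2
  apply (algebraMap K L).injective
  rw [map_pow (algebraMap K L), FiniteField.algebraMap_trace_eq_sum_pow, FiniteField.algebraMap_trace_eq_sum_pow,
    sum_pow_char 2]
  exact Finset.sum_congr rfl fun i _ => by rw [← pow_mul, ← pow_mul, mul_comm]

/-- With $u=(a,x)$ and $\tau=T(sx)$ the value is $a\tau+T((sx)^2)+\tau^2+a\tau$, and
$T((sx)^2)=\tau^2$, so the terms cancel in pairs. -/
theorem kerdockForm_self [Finite K] [Finite L] [CharP K 2] (s : L) (u : K × L) :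
    kerdockForm s u u = 0 := by
  have h1 : u.2 * (s ^ 2 * u.2 + s * algebraMap K L (Algebra.trace K L (s * u.2)) + u.1 • s) =
      (s * u.2) ^ 2 + Algebra.trace K L (s * u.2) • (s * u.2) + u.1 • (s * u.2) := by
    simp only [Algebra.smul_def]
    ring
  rw [kerdockForm_apply, h1, map_add, map_add, trace_sq_of_charTwo, map_smul, map_smul,
    smul_eq_mul, smul_eq_mul]
  have := CharTwo.two_eq_zero (R := K)
  linear_combination (u.1 * Algebra.trace K L (s * u.2) + Algebra.trace K L (s * u.2) ^ 2) * this

/-- Write $u=(a,x)$. Testing against $(1,0)$ gives $T(sx)=T(tx)=c$; testing against $(0,y)$ gives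
$s^2x+cs+as=t^2x+ct+at$. If $s\ne t$, then $(s-t)x=c+a$ is a scalar of trace $0$. In odd degree and
characteristic $2$ a scalar equals its own trace, so it vanishes; then $x=0$, $c=0$ and $a=0$. -/
theorem eq_of_kerdockForm_eq [Finite K] [Finite L] [CharP K 2] (hodd : Odd (finrank K L))
    (s t : L) (u : K × L) (h : kerdockForm s u = kerdockForm t u) (hu : u ≠ 0) : s = t := by
  have : CharP L 2 := charP_of_injective_algebraMap (algebraMap K L).injective 2
  have h1 := LinearMap.congr_fun h (1, 0)
  simp only [kerdockForm_apply, one_mul, zero_mul, map_zero, add_zero] at h1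
  have h2 := sub_eq_zero.mp <| (traceForm_nondegenerate K L).2
    ((s ^ 2 * u.2 + s * algebraMap K L (Algebra.trace K L (s * u.2)) + u.1 • s) -
      (t ^ 2 * u.2 + t * algebraMap K L (Algebra.trace K L (t * u.2)) + u.1 • t)) fun y => by
    have := LinearMap.congr_fun h (0, y)
    simp only [kerdockForm_apply, zero_mul, zero_add] at this
    rw [Algebra.traceForm_apply, mul_sub, map_sub, this, sub_self]
  rw [← h1] at h2
  by_contra hst
  set c := Algebra.trace K L (s * u.2) with hc
  have hst' : s - t ≠ 0 := sub_ne_zero.mpr hst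
  have htwo := CharTwo.two_eq_zero (R := L)
  -- In characteristic $2$, $s^2-t^2=(s-t)^2$, so one factor $s-t$ cancels.
  have h3 : (s - t) * u.2 = algebraMap K L (c + u.1) := by
    apply mul_left_cancel₀ hst'
    rw [Algebra.smul_def, Algebra.smul_def] at h2
    rw [map_add]
    linear_combination h2 - (s * t * u.2 - t ^ 2 * u.2 +
      (s - t) * (algebraMap K L c + algebraMap K L u.1)) * htwo
  have h4 : Algebra.trace K L ((s - t) * u.2) = 0 := by rw [sub_mul, map_sub, ← h1, sub_self]
  rw [h3, Algebra.trace_algebraMap] at h4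
  have hone : (finrank K L : K) = 1 := by
    obtain ⟨r, hr⟩ := hodd
    rw [hr]
    push_cast
    rw [CharTwo.two_eq_zero, zero_mul, zero_add]
  rw [nsmul_eq_mul, hone, one_mul] at h4
  rw [h4, map_zero, mul_eq_zero, or_iff_right hst'] at h3
  rw [hc, h3, mul_zero, map_zero, zero_add] at h4
  exact hu (Prod.ext h4 h3)

end KerdockField

/-! ### Existence of orthogonal spreads -/

section Existence

variable {K V : Type*} [Field K] [Finite K] [CharP K 2] [AddCommGroup V] [Module K V]

theorem IsOrthogonalPlusSpace.exists_isOrthogonalSpread {Q : QuadraticForm K V} {m : ℕ}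
    (hm : m ≠ 0) (hQ : IsOrthogonalPlusSpace Q (2 * m)) : ∃ S, IsOrthogonalSpread Q S := by
  have : Fact (Nat.Prime 2) := ⟨Nat.prime_two⟩
  have : NeZero (2 * m - 1) := ⟨by omega⟩
  -- The degree is odd, as the Kerdock set requires. It makes $K\times L$ of dimension $2m$ and
  -- gives $|L|=|K|^{2m-1}$ forms, exactly the number needed.
  let L := FiniteField.Extension K 2 (2 * m - 1)
  have hL : finrank K L = 2 * m - 1 := FiniteField.finrank_extension K 2 (2 * m - 1)
  have hdim : finrank K (K × L) = 2 * m := by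
    rw [finrank_prod, finrank_self, hL]
    omega
  obtain ⟨e, he⟩ := hQ.exists_equiv_dualProd (K × L) hdim
  obtain ⟨S, hS⟩ := exists_isOrthogonalSpread_dualProd (K := K) (M := K × L) (ι := L) kerdockForm
    kerdockForm_self (eq_of_kerdockForm_eq (by rw [hL]; exact ⟨m - 1, by omega⟩))
    (by rw [Module.natCard_eq_pow_finrank (K := K), hdim, hL])
  exact ⟨_, hS.map e he⟩

end Existence

/-! ### Common zeros of quadratic forms -/

section ChevalleyWarning

/-- Fewer than `dim V / 2` quadratic forms over a finite field have a common nontrivial zero. -/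
theorem exists_ne_zero_forall_quadraticForm_eq_zero {K V ι : Type*} [Field K] [Finite K]
    [AddCommGroup V] [Module K V] [Module.Finite K V] [Fintype ι] (Q : ι → QuadraticForm K V)
    (h : 2 * Fintype.card ι < finrank K V) : ∃ v, v ≠ 0 ∧ ∀ i, Q i v = 0 := by
  classical
  have := Fintype.ofFinite K
  obtain ⟨p, hp⟩ := CharP.exists K
  have : Fact p.Prime := ⟨CharP.char_is_prime K p⟩
  choose β hβ using fun i => LinearMap.BilinMap.toQuadraticMap_surjective (Q i)
  let e := finBasis K V
  let f : ι → MvPolynomial (Fin (finrank K V)) K := fun i =>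
    ∑ a, ∑ b, MvPolynomial.C (β i (e a) (e b)) * (MvPolynomial.X a * MvPolynomial.X b)
  have hdeg (i) : (f i).totalDegree ≤ 2 := by
    refine MvPolynomial.totalDegree_finsetSum_le fun a _ =>
      MvPolynomial.totalDegree_finsetSum_le fun b _ => ?_
    refine (MvPolynomial.totalDegree_mul _ _).trans ?_
    rw [MvPolynomial.totalDegree_C, zero_add]
    refine (MvPolynomial.totalDegree_mul _ _).trans ?_
    rw [MvPolynomial.totalDegree_X, MvPolynomial.totalDegree_X]
  have heval (i) (x : Fin (finrank K V) → K) :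
      MvPolynomial.eval x (f i) = Q i (e.equivFun.symm x) := by
    rw [← hβ i, LinearMap.BilinMap.toQuadraticMap_apply]
    simp only [f, Basis.equivFun_symm_apply, map_sum, map_smul, LinearMap.sum_apply,
      LinearMap.smul_apply, map_mul, MvPolynomial.eval_C, MvPolynomial.eval_X, smul_eq_mul]
    rw [Finset.sum_comm]
    refine Finset.sum_congr rfl fun a _ => ?_
    rw [Finset.mul_sum]
    exact Finset.sum_congr rfl fun b _ => by ring
  have hsum : (∑ i, (f i).totalDegree) < Fintype.card (Fin (finrank K V)) := by
    rw [Fintype.card_fin]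
    refine lt_of_le_of_lt ((Finset.sum_le_card_nsmul _ _ 2 fun i _ => hdeg i)) ?_
    rwa [smul_eq_mul, mul_comm, Finset.card_univ]
  -- The number of common zeros is divisible by $p$ and positive because of the zero vector, so
  -- there is a second zero.
  have hdvd := char_dvd_card_solutions_of_fintype_sum_lt p hsum
  have hcard : 1 < Fintype.card {x : Fin (finrank K V) → K // ∀ i, MvPolynomial.eval x (f i) = 0} :=
    (CharP.char_is_prime K p).one_lt.trans_le
      (Nat.le_of_dvd (Fintype.card_pos_iff.mpr ⟨⟨0, fun i => by rw [heval]; simp⟩⟩) hdvd)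
  obtain ⟨⟨x, hx⟩, hne⟩ := Fintype.exists_ne_of_one_lt_card hcard
    ⟨0, fun i => by rw [heval]; simp⟩
  refine ⟨e.equivFun.symm x, fun h0 => hne (Subtype.ext ?_), fun i => by rw [← heval, hx]⟩
  exact (LinearEquiv.map_eq_zero_iff _).mp h0

end ChevalleyWarning

/-! ### Restriction of scalars and the trace form -/

section RestrictScalars

variable {E F V : Type*} [Field E] [Field F] [Algebra E F]
  [AddCommGroup V] [Module F V] [Module E V] [IsScalarTower E F V]

/-- The coordinates of $Q$ in an $E$-basis of $F$ are $[F:E]$ quadratic forms on `Y` over $E$; their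
common zeros are the vectors singular for $Q$. -/
theorem exists_singular_of_two_mul_finrank_lt [Finite E] [Module.Finite E F] [Module.Finite E V]
    (Q : QuadraticForm F V) (Y : Submodule E V) (h : 2 * finrank E F < finrank E Y) :
    ∃ y ∈ Y, y ≠ 0 ∧ Q y = 0 := by
  let b := finBasis E F
  obtain ⟨y, hy0, hy⟩ := exists_ne_zero_forall_quadraticForm_eq_zero
    (fun i => ((b.coord i).compQuadraticMap' Q).comp Y.subtype) (by rwa [Fintype.card_fin])
  refine ⟨y, y.2, fun h0 => hy0 (Subtype.ext h0), ?_⟩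
  exact b.ext_elem fun i => by
    rw [map_zero, Finsupp.zero_apply]
    exact hy i

theorem finrank_restrictScalars_eq (X : Submodule F V) :
    finrank E (X.restrictScalars E) = finrank E F * finrank F X :=
  (finrank_mul_finrank E F X).symm

theorem IsTotallySingular.restrictScalars {Q : QuadraticForm F V} {X : Submodule F V}
    (hX : IsTotallySingular Q X) : IsTotallySingular (traceForm E Q) (X.restrictScalars E) :=
  fun x hx => by rw [traceForm_apply, hX x hx, map_zero]

theorem IsPartialSpread.restrictScalars {S : Set (Submodule F V)} (hS : IsPartialSpread F V S) :
    IsPartialSpread E V (restrictSpread E S) := by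
  refine ⟨?_, ?_⟩
  · rintro _ ⟨X, hX, rfl⟩
    rw [finrank_restrictScalars_eq, ← finrank_mul_finrank E F V, ← hS.half_dim X hX]
    ring
  · rintro _ ⟨X, hX, rfl⟩ _ ⟨Y, hY, rfl⟩ hne
    have := hS.inf_eq_bot X hX Y hY fun h => hne (by rw [h])
    rw [eq_bot_iff] at this ⊢
    exact fun v hv => this hv

theorem IsOrthogonalPartialSpread.restrictScalars {Q : QuadraticForm F V}
    {S : Set (Submodule F V)} (hS : IsOrthogonalPartialSpread Q S) :
    IsOrthogonalPartialSpread (traceForm E Q) (restrictSpread E S) := by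
  refine ⟨hS.1.restrictScalars, ?_⟩
  rintro _ ⟨X, hX, rfl⟩
  exact (hS.2 X hX).restrictScalars

theorem ncard_restrictSpread (S : Set (Submodule F V)) :
    (restrictSpread E S).ncard = S.ncard :=
  Set.ncard_image_of_injective _ (Submodule.restrictScalars_injective E F V)

theorem polar_traceForm (Q : QuadraticForm F V) (x y : V) :
    QuadraticMap.polar (traceForm E Q) x y = Algebra.trace E F (QuadraticMap.polar Q x y) := by
  simp only [QuadraticMap.polar, traceForm_apply, map_sub]

theorem nondegenerate_polarBilin_of_separatingLeft {K W : Type*} [Field K] [AddCommGroup W]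
    [Module K W] {Q : QuadraticForm K W}
    (h : ∀ x, (∀ y, QuadraticMap.polar Q x y = 0) → x = 0) : Q.polarBilin.Nondegenerate :=
  ⟨h, fun x hx => h x fun y => by
    rw [QuadraticMap.polar_comm]
    exact hx y⟩

theorem IsOrthogonalPlusSpace.traceForm [Finite E] [Module.Finite E F] {Q : QuadraticForm F V}
    {n : ℕ} (hQ : IsOrthogonalPlusSpace Q n) :
    IsOrthogonalPlusSpace (traceForm E Q) (n * finrank E F) := by
  have := hQ.finite
  have : Finite F := Module.finite_of_finite E
  refine ⟨Module.Finite.trans F V, ?_, nondegenerate_polarBilin_of_separatingLeft ?_, ?_⟩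
  · rw [← finrank_mul_finrank E F V, hQ.finrank_eq]
    ring
  · intro x hx
    refine hQ.nondegenerate.1 x fun y => ?_
    -- Replacing $y$ by $cy$ for all $c\in F$ turns the vanishing of the traces into the vanishing
    -- of the polar form of $Q$, as the trace form of $F/E$ is nondegenerate.
    refine (traceForm_nondegenerate E F).1 _ fun c => ?_
    rw [Algebra.traceForm_apply, mul_comm, ← hx (c • y), polar_traceForm,
      QuadraticMap.polar_smul_right, smul_eq_mul]
    rfl
  · obtain ⟨U, hU, hn⟩ := hQ.exists_singular
    exact ⟨U.restrictScalars E, hU.restrictScalars,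
      by rw [finrank_restrictScalars_eq, hn, mul_comm]⟩

/-- An orthogonal spread of a space of plus type over `F` with large enough dimension remains
maximal among the partial spreads over the subfield `E`. -/
theorem IsOrthogonalSpread.maximal_restrictSpread [Finite E] [Module.Finite E F]
    [Module.Finite F V] {Q : QuadraticForm F V} {S : Set (Submodule F V)}
    (hS : IsOrthogonalSpread Q S) (hdim : 4 < finrank F V) :
    Maximal (IsPartialSpread E V) (restrictSpread E S) := by
  have : Module.Finite E V := Module.Finite.trans F V
  refine ⟨hS.1.1.restrictScalars, fun T hT hST Y hY => ?_⟩
  have hpos : 0 < finrank E F := finrank_pos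
  have hY2 := hT.half_dim Y hY
  rw [← finrank_mul_finrank E F V] at hY2
  obtain ⟨y, hyY, hy0, hy⟩ := exists_singular_of_two_mul_finrank_lt Q Y (by nlinarith)
  obtain ⟨X, hX, hyX⟩ := hS.2 y hy
  by_contra hYS
  have hX' : X.restrictScalars E ∈ restrictSpread E S := ⟨X, hX, rfl⟩
  have hmem : y ∈ Y ⊓ X.restrictScalars E := ⟨hyY, hyX⟩
  rw [hT.inf_eq_bot Y hY _ (hST hX') fun h => hYS (h ▸ hX')] at hmem
  exact hy0 hmem

end RestrictScalars

/-! ### Projection from a nonsingular point -/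

section Projection

variable {K V : Type*} [Field K] [AddCommGroup V] [Module K V]

theorem mem_perp_iff {Q : QuadraticForm K V} {z v : V} :
    v ∈ perp Q z ↔ QuadraticMap.polar Q z v = 0 := Iff.rfl

theorem polar_self_of_charTwo [CharP K 2] (Q : QuadraticForm K V) (x : V) :
    QuadraticMap.polar Q x x = 0 := by
  rw [QuadraticMap.polar_self, nsmul_eq_mul, Nat.cast_ofNat, CharTwo.two_eq_zero, zero_mul]

theorem self_mem_perp [CharP K 2] (Q : QuadraticForm K V) (z : V) : z ∈ perp Q z :=
  polar_self_of_charTwo Q z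

/-- This identity controls singular vectors in a coset of $\langle z\rangle$: for nonsingular `z`,
it makes projection injective on singular vectors in characteristic two, and lets $c$ be chosen to
make a coset representative singular. -/
theorem map_add_smul_of_mem_perp {Q : QuadraticForm K V} {z v : V} (hv : v ∈ perp Q z) (c : K) :
    Q (v + c • z) = Q v + c * c * Q z := by
  rw [QuadraticMap.map_add Q, QuadraticMap.polar_smul_right, QuadraticMap.polar_comm,
    mem_perp_iff.mp hv, QuadraticMap.map_smul, smul_zero, add_zero, smul_eq_mul]

theorem mkQ_eq_zero_iff {Q : QuadraticForm K V} {z : V} {x : perp Q z} :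
    (lineInPerp Q z).mkQ x = 0 ↔ ∃ c : K, c • z = (x : V) := by
  rw [← LinearMap.mem_ker, Submodule.ker_mkQ]
  exact Submodule.mem_span_singleton

theorem mkQ_eq_mkQ_iff {Q : QuadraticForm K V} {z : V} {x y : perp Q z} :
    (lineInPerp Q z).mkQ x = (lineInPerp Q z).mkQ y ↔ ∃ c : K, (x : V) = y + c • z := by
  rw [← sub_eq_zero, ← map_sub, mkQ_eq_zero_iff]
  refine exists_congr fun c => ?_
  rw [Submodule.coe_sub, eq_sub_iff_add_eq, eq_comm, add_comm]

theorem projectSubspace_eq (Q : QuadraticForm K V) (z : V) (X : Submodule K V) :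
    projectSubspace Q z X = (X.comap (perp Q z).subtype).map (lineInPerp Q z).mkQ := by
  apply le_antisymm
  · rintro _ ⟨w, hw, rfl⟩
    obtain ⟨a, ha, b, hb, hab⟩ := Submodule.mem_sup.mp hw
    obtain ⟨c, rfl⟩ := Submodule.mem_span_singleton.mp hb
    refine ⟨⟨a, ha.1⟩, ha.2, ?_⟩
    rw [eq_comm, mkQ_eq_mkQ_iff]
    exact ⟨c, hab.symm⟩
  · exact Submodule.map_mono fun w hw => Submodule.mem_sup_left ⟨w.2, hw⟩

/-- A functional vanishing on the kernel of another is a multiple of it, and nondegeneracy carries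
the multiple back to vectors. Thus the radical of $z^\perp$ is contained in $\langle z\rangle$. -/
theorem eq_smul_of_polar_eq_zero [Module.Finite K V] {Q : QuadraticForm K V}
    (hQ : Q.polarBilin.Nondegenerate) {x z : V}
    (h : ∀ y ∈ perp Q z, QuadraticMap.polar Q x y = 0) : ∃ c : K, c • z = x := by
  have hmem := FiniteDimensional.mem_span_of_iInf_ker_le_ker
    (L := fun _ : Unit => Q.polarBilin z) (K := Q.polarBilin x) (by simpa using! h)
  rw [Set.range_const, Submodule.mem_span_singleton] at hmem
  obtain ⟨c, hc⟩ := hmem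
  refine ⟨c, sub_eq_zero.mp (hQ.1 _ fun y => ?_)⟩
  rw [map_sub, map_smul, hc, sub_self, LinearMap.zero_apply]

variable {Q : QuadraticForm K V} {z : V} {n : ℕ}

theorem IsOrthogonalPlusSpace.finrank_perp (hQ : IsOrthogonalPlusSpace Q n) (hz : z ≠ 0) :
    finrank K (perp Q z) + 1 = 2 * n := by
  have := hQ.finite
  rw [← hQ.finrank_eq]
  exact Module.Dual.finrank_ker_add_one_of_ne_zero (f := Q.polarBilin z)
    fun h => hz (hQ.nondegenerate.1 z fun y => LinearMap.congr_fun h y)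

theorem finrank_lineInPerp [CharP K 2] (Q : QuadraticForm K V) (hz : z ≠ 0) :
    finrank K (lineInPerp Q z) = 1 := by
  rw [← finrank_span_singleton (K := K) hz]
  exact (Submodule.comapSubtypeEquivOfLe
    ((Submodule.span_singleton_le_iff_mem _ _).mpr (self_mem_perp Q z))).finrank_eq

theorem IsOrthogonalPlusSpace.isSymplecticSpace_quotientForm [CharP K 2] (hQ : IsOrthogonalPlusSpace Q n)
    (hz : z ≠ 0) : IsSymplecticSpace (quotientForm Q z) (2 * n - 2) := by
  have := hQ.finite
  refine ⟨inferInstance, ?_, ?_, ?_⟩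
  · have h1 := hQ.finrank_perp hz
    have h2 : finrank K (PerpQuotient Q z) + _ = _ := Submodule.finrank_quotient_add_finrank (lineInPerp Q z)
    rw [finrank_lineInPerp Q hz] at h2
    omega
  · intro w
    obtain ⟨x, rfl⟩ := (lineInPerp Q z).mkQ_surjective w
    exact (quotientForm_mk Q z x x).trans (polar_self_of_charTwo Q x)
  · have hsep (w : PerpQuotient Q z) (h : ∀ w', quotientForm Q z w w' = 0) : w = 0 := by
      obtain ⟨x, rfl⟩ := (lineInPerp Q z).mkQ_surjective w
      rw [mkQ_eq_zero_iff]
      refine eq_smul_of_polar_eq_zero hQ.nondegenerate fun y hy => ?_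
      rw [← quotientForm_mk Q z x ⟨y, hy⟩]
      exact h _
    refine ⟨hsep, fun w hw => hsep w fun w' => ?_⟩
    obtain ⟨x, rfl⟩ := (lineInPerp Q z).mkQ_surjective w
    obtain ⟨y, rfl⟩ := (lineInPerp Q z).mkQ_surjective w'
    rw [quotientForm_mk, QuadraticMap.polar_comm, ← quotientForm_mk]
    exact hw _

theorem ne_zero_of_map_ne_zero (hz : Q z ≠ 0) : z ≠ 0 := by
  rintro rfl
  exact hz (QuadraticMap.map_zero Q)

/-- As $X=X^\perp$ and `z` is nonsingular, $z\notin X^\perp$, so $z^\perp\cap X$ is a hyperplane of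
`X`. It contains no nonzero multiple of `z`, hence embeds in the quotient. -/
theorem IsOrthogonalPlusSpace.finrank_projectSubspace (hQ : IsOrthogonalPlusSpace Q n)
    (hz : Q z ≠ 0) {X : Submodule K V} (hX : IsTotallySingular Q X) (hn : finrank K X = n) :
    finrank K (projectSubspace Q z X) + 1 = n := by
  have := hQ.finite
  let φ : Dual K X := polarRestrict Q X z
  have hφ : φ ≠ 0 := fun h =>
    hz (hX z (hQ.ker_polarRestrict hX hn ▸ LinearMap.mem_ker.mpr h))
  let g : LinearMap.ker φ →ₗ[K] PerpQuotient Q z := (lineInPerp Q z).mkQ ∘ₗ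
    ((X.subtype ∘ₗ (LinearMap.ker φ).subtype).codRestrict (perp Q z) fun x => x.2)
  have hg (x) : g x = (lineInPerp Q z).mkQ ⟨x.1, x.2⟩ := rfl
  have hinj : Function.Injective g := by
    rw [← LinearMap.ker_eq_bot, LinearMap.ker_eq_bot']
    intro x hx
    rw [hg, mkQ_eq_zero_iff] at hx
    obtain ⟨c, hc⟩ := hx
    have h0 := hX _ x.1.2
    rw [← hc, QuadraticMap.map_smul, smul_eq_mul, mul_eq_zero, or_iff_left hz,
      mul_self_eq_zero] at h0
    rw [h0, zero_smul] at hc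
    exact Subtype.ext (Subtype.ext hc.symm)
  have hrange : LinearMap.range g = projectSubspace Q z X := by
    rw [projectSubspace_eq]
    apply le_antisymm
    · rintro _ ⟨x, rfl⟩
      exact ⟨⟨x.1, x.2⟩, x.1.2, rfl⟩
    · rintro _ ⟨y, hy, rfl⟩
      exact ⟨⟨⟨y, hy⟩, y.2⟩, rfl⟩
  rw [← hrange, LinearMap.finrank_range_of_inj hinj, ← hn]
  exact Module.Dual.finrank_ker_add_one_of_ne_zero hφ

/-- Singular $x\in X$ and $y\in Y$ with the same image differ by $cz$; then $c^2Q(z)=0$ forces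
$c=0$, so $x=y\in X\cap Y$. -/
theorem projectSubspace_inf_eq_bot (hz : Q z ≠ 0) {X Y : Submodule K V}
    (hX : IsTotallySingular Q X) (hY : IsTotallySingular Q Y) (hXY : X ⊓ Y = ⊥) :
    projectSubspace Q z X ⊓ projectSubspace Q z Y = ⊥ := by
  rw [projectSubspace_eq, projectSubspace_eq, eq_bot_iff]
  rintro _ ⟨⟨x, hx, rfl⟩, ⟨y, hy, hxy⟩⟩
  obtain ⟨c, hc⟩ := mkQ_eq_mkQ_iff.mp hxy
  have h0 := map_add_smul_of_mem_perp x.2 c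
  rw [← hc, show Q y = 0 from hY _ hy, show Q x = 0 from hX _ hx, zero_add, eq_comm, mul_eq_zero, or_iff_left hz,
    mul_self_eq_zero] at h0
  rw [h0, zero_smul, add_zero] at hc
  have hmem : (x : V) ∈ X ⊓ Y := ⟨hx, hc ▸ hy⟩
  rw [hXY, Submodule.mem_bot, Submodule.coe_eq_zero] at hmem
  rw [hmem, map_zero]
  exact Submodule.zero_mem _

theorem isTotallyIsotropic_projectSubspace {X : Submodule K V} (hX : IsTotallySingular Q X) :
    IsTotallyIsotropic (quotientForm Q z) (projectSubspace Q z X) := by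
  rw [projectSubspace_eq]
  rintro _ ⟨x, hx, rfl⟩ _ ⟨y, hy, rfl⟩
  rw [quotientForm_mk]
  exact hX.polar_eq_zero hx hy

theorem IsOrthogonalPartialSpread.finrank_eq (hQ : IsOrthogonalPlusSpace Q n)
    {S : Set (Submodule K V)} (hS : IsOrthogonalPartialSpread Q S) {X : Submodule K V}
    (hX : X ∈ S) : finrank K X = n := by
  have := hS.1.half_dim X hX
  rw [hQ.finrank_eq] at this
  omega

/-- The projection of an orthogonal partial spread is a symplectic partial spread. -/
theorem IsOrthogonalPartialSpread.projectSubspace [CharP K 2] (hQ : IsOrthogonalPlusSpace Q n)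
    (hz : Q z ≠ 0) {S : Set (Submodule K V)} (hS : IsOrthogonalPartialSpread Q S) :
    IsSymplecticPartialSpread (quotientForm Q z) (projectSubspace Q z '' S) := by
  refine ⟨⟨?_, ?_⟩, ?_⟩
  · rintro _ ⟨X, hX, rfl⟩
    have h1 := hQ.finrank_projectSubspace hz (hS.2 X hX) (hS.finrank_eq hQ hX)
    rw [(hQ.isSymplecticSpace_quotientForm (ne_zero_of_map_ne_zero hz)).finrank_eq]
    omega
  · rintro _ ⟨X, hX, rfl⟩ _ ⟨Y, hY, rfl⟩ hne
    exact projectSubspace_inf_eq_bot hz (hS.2 X hX) (hS.2 Y hY)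
      (hS.1.inf_eq_bot X hX Y hY fun h => hne (by rw [h]))
  · rintro _ ⟨X, hX, rfl⟩
    exact isTotallyIsotropic_projectSubspace (hS.2 X hX)

/-- Distinct members with equal projections would have zero projection, whereas projections have
dimension $n-1\ge 1$. -/
theorem IsOrthogonalPartialSpread.ncard_projectSubspace (hn : 2 ≤ n)
    (hQ : IsOrthogonalPlusSpace Q n) (hz : Q z ≠ 0) {S : Set (Submodule K V)}
    (hS : IsOrthogonalPartialSpread Q S) :
    (PartialSpread.projectSubspace Q z '' S).ncard = S.ncard := by
  refine Set.InjOn.ncard_image fun X hX Y hY h => ?_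
  by_contra hne
  have hbot := projectSubspace_inf_eq_bot hz (hS.2 X hX) (hS.2 Y hY)
    (hS.1.inf_eq_bot X hX Y hY hne)
  rw [← h, inf_idem] at hbot
  have hf := hQ.finrank_projectSubspace hz (hS.2 X hX) (hS.finrank_eq hQ hX)
  rw [hbot, finrank_bot] at hf
  omega

/-- The singular vectors of `z^⊥` lying over a totally isotropic subspace `Y` of `z^⊥ / z`. -/
def singularLift (Q : QuadraticForm K V) (z : V) (Y : Submodule K (PerpQuotient Q z))
    (hY : IsTotallyIsotropic (quotientForm Q z) Y) : Submodule K V where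
  carrier := {v | Q v = 0 ∧ ∃ hv : v ∈ perp Q z, (lineInPerp Q z).mkQ ⟨v, hv⟩ ∈ Y}
  zero_mem' := ⟨QuadraticMap.map_zero Q, Submodule.zero_mem _, Y.zero_mem⟩
  add_mem' := by
    rintro v w ⟨hv0, hv, hvY⟩ ⟨hw0, hw, hwY⟩
    refine ⟨?_, (perp Q z).add_mem hv hw, Y.add_mem hvY hwY⟩
    rw [QuadraticMap.map_add Q, hv0, hw0, ← quotientForm_mk Q z ⟨v, hv⟩ ⟨w, hw⟩,
      hY _ hvY _ hwY, zero_add, zero_add]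
  smul_mem' := by
    rintro c v ⟨hv0, hv, hvY⟩
    refine ⟨?_, (perp Q z).smul_mem c hv, Y.smul_mem c hvY⟩
    rw [QuadraticMap.map_smul, hv0, smul_zero]

theorem finrank_singularLift [Finite K] [CharP K 2] (hz : Q z ≠ 0) (Y : Submodule K (PerpQuotient Q z))
    (hY : IsTotallyIsotropic (quotientForm Q z) Y) :
    finrank K (singularLift Q z Y hY) = finrank K Y := by
  let g : singularLift Q z Y hY →ₗ[K] Y :=
    ((lineInPerp Q z).mkQ ∘ₗ (singularLift Q z Y hY).subtype.codRestrict (perp Q z)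
      fun x => x.2.2.choose).codRestrict Y fun x => x.2.2.choose_spec
  have hg (x) : (g x : PerpQuotient Q z) = (lineInPerp Q z).mkQ ⟨x, x.2.2.choose⟩ := rfl
  refine (LinearEquiv.ofBijective g ⟨?_, fun y => ?_⟩).finrank_eq
  · rw [← LinearMap.ker_eq_bot, LinearMap.ker_eq_bot']
    intro x hx
    rw [← Submodule.coe_eq_zero, hg, mkQ_eq_zero_iff] at hx
    obtain ⟨c, hc⟩ := hx
    have h0 := x.2.1
    rw [← show c • z = (x : V) from hc, QuadraticMap.map_smul, smul_eq_mul, mul_eq_zero,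
      or_iff_left hz, mul_self_eq_zero] at h0
    rw [h0, zero_smul] at hc
    exact Subtype.ext hc.symm
  · obtain ⟨w, hw⟩ := (lineInPerp Q z).mkQ_surjective (y : PerpQuotient Q z)
    -- Taking $c^2=Q(w)/Q(z)$ makes $Q(w+cz)=2Q(w)=0$.
    obtain ⟨c, hc⟩ := FiniteField.isSquare_of_char_two (ringChar.eq K 2) (Q w / Q z)
    let x : V := w + c • z
    have hx : x ∈ perp Q z :=
      (perp Q z).add_mem w.2 ((perp Q z).smul_mem c (self_mem_perp Q z))
    have hmk : (lineInPerp Q z).mkQ ⟨x, hx⟩ = y := by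
      rw [← hw, mkQ_eq_mkQ_iff]
      exact ⟨c, rfl⟩
    have hQx : Q x = 0 := by
      rw [map_add_smul_of_mem_perp w.2, ← hc, div_mul_cancel₀ _ hz, CharTwo.add_self_eq_zero]
    exact ⟨⟨x, hQx, hx, hmk ▸ y.2⟩, Subtype.ext hmk⟩

/-- If an orthogonal partial spread meets every totally singular subspace of dimension `n - 1`,
then its projection from a nonsingular point is a maximal symplectic partial spread. -/
theorem IsOrthogonalPartialSpread.maximal_projectSubspace [Finite K] [CharP K 2]
    (hQ : IsOrthogonalPlusSpace Q n) (hz : Q z ≠ 0) {S : Set (Submodule K V)}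
    (hS : IsOrthogonalPartialSpread Q S)
    (hmeet : ∀ Y : Submodule K V, IsTotallySingular Q Y → finrank K Y + 1 = n →
      ∃ y ∈ Y, y ≠ 0 ∧ ∃ X ∈ S, y ∈ X) :
    Maximal (IsSymplecticPartialSpread (quotientForm Q z))
      (PartialSpread.projectSubspace Q z '' S) := by
  refine ⟨hS.projectSubspace hQ hz, fun T hT hST Y hY => ?_⟩
  have hiso := hT.2 Y hY
  have hzne := ne_zero_of_map_ne_zero hz
  have hdim : finrank K (singularLift Q z Y hiso) + 1 = n := by
    have h1 := hT.1.half_dim Y hY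
    rw [(hQ.isSymplecticSpace_quotientForm hzne).finrank_eq] at h1
    have h2 := hQ.finrank_perp hzne
    rw [finrank_singularLift hz Y hiso]
    omega
  obtain ⟨y, ⟨hQy, hyp, hyY⟩, hy0, X, hX, hyX⟩ :=
    hmeet (singularLift Q z Y hiso) (fun x hx => hx.1) hdim
  have hX' : PartialSpread.projectSubspace Q z X ∈ PartialSpread.projectSubspace Q z '' S :=
    ⟨X, hX, rfl⟩
  by_contra hYS
  have hmem : (lineInPerp Q z).mkQ ⟨y, hyp⟩ ∈ Y ⊓ PartialSpread.projectSubspace Q z X := by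
    refine ⟨hyY, ?_⟩
    rw [projectSubspace_eq]
    exact ⟨⟨y, hyp⟩, hyX, rfl⟩
  rw [hT.1.inf_eq_bot Y hY _ (hST hX') fun h => hYS (h ▸ hX'), Submodule.mem_bot,
    mkQ_eq_zero_iff] at hmem
  obtain ⟨c, hc⟩ := hmem
  replace hc : c • z = y := hc
  rw [← hc, QuadraticMap.map_smul, smul_eq_mul, mul_eq_zero, or_iff_left hz,
    mul_self_eq_zero] at hQy
  exact hy0 (by rw [← hc, hQy, zero_smul])

end Projection

/-! ### Uniqueness of symplectic spaces -/

section Symplectic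

variable {K V : Type*} [Field K] [AddCommGroup V] [Module K V] {B : LinearMap.BilinForm K V}

theorem isTotallyIsotropic_bot (B : LinearMap.BilinForm K V) :
    IsTotallyIsotropic B (⊥ : Submodule K V) := by
  intro x hx y _
  rw [(Submodule.mem_bot K).mp hx, map_zero, LinearMap.zero_apply]

theorem IsTotallyIsotropic.sup_span_singleton (hB : B.IsAlt) {X : Submodule K V}
    (hX : IsTotallyIsotropic B X) {v : V} (hv : v ∈ LinearMap.BilinForm.orthogonal B X) :
    IsTotallyIsotropic B (X ⊔ Submodule.span K {v}) := by
  intro x hx y hy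
  obtain ⟨x', hx', a, ha, rfl⟩ := Submodule.mem_sup.mp hx
  obtain ⟨y', hy', b, hb, rfl⟩ := Submodule.mem_sup.mp hy
  obtain ⟨c, rfl⟩ := Submodule.mem_span_singleton.mp ha
  obtain ⟨d, rfl⟩ := Submodule.mem_span_singleton.mp hb
  have h1 : B x' v = 0 := hv x' hx'
  have h2 : B v y' = 0 := hB.isRefl _ _ (hv y' hy')
  simp [h1, h2, hX x' hx' y' hy', hB.self_eq_zero v]

/-- A totally isotropic subspace `X` which is maximal among those disjoint from `U` satisfies
`X^⊥ ≤ X + U`. -/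
theorem exists_isTotallyIsotropic_disjoint [Module.Finite K V] (hB : B.IsAlt)
    (U : Submodule K V) :
    ∃ X : Submodule K V, IsTotallyIsotropic B X ∧ X ⊓ U = ⊥ ∧
      LinearMap.BilinForm.orthogonal B X ≤ X ⊔ U := by
  let P : Submodule K V → Prop := fun X => IsTotallyIsotropic B X ∧ X ⊓ U = ⊥
  obtain ⟨X, hX⟩ := exists_maximal_of_wellFoundedGT P
    ⟨⊥, isTotallyIsotropic_bot B, bot_inf_eq U⟩
  refine ⟨X, hX.1.1, hX.1.2, fun v hv => ?_⟩
  by_contra hvXU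
  have hvX : P (X ⊔ Submodule.span K {v}) := by
    refine ⟨hX.1.1.sup_span_singleton hB hv, ?_⟩
    rw [eq_bot_iff]
    rintro x ⟨hx, hxU⟩
    obtain ⟨x', hx', a, ha, rfl⟩ := Submodule.mem_sup.mp hx
    obtain ⟨c, rfl⟩ := Submodule.mem_span_singleton.mp ha
    have hc : c = 0 := by
      by_contra hc
      refine hvXU ?_
      have hcv : c • v ∈ X ⊔ U := by
        have := (X ⊔ U).sub_mem (Submodule.mem_sup_right hxU) (Submodule.mem_sup_left hx')
        rwa [add_sub_cancel_left] at this
      exact (Submodule.smul_mem_iff _ hc).mp hcv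
    rw [hc, zero_smul, add_zero] at hxU ⊢
    exact hX.1.2 ▸ (⟨hx', hxU⟩ : x' ∈ X ⊓ U)
  have := hX.2 hvX le_sup_left (Submodule.mem_sup_right (Submodule.mem_span_singleton_self v))
  exact hvXU (Submodule.mem_sup_left this)

/-- A symplectic space is the sum of two complementary Lagrangian subspaces. -/
theorem IsSymplecticSpace.exists_lagrangian_pair {d : ℕ} (hB : IsSymplecticSpace B d) :
    ∃ U X : Submodule K V, IsTotallyIsotropic B U ∧ IsTotallyIsotropic B X ∧ IsCompl U X := by
  have := hB.finite
  have hle {X : Submodule K V} (hX : IsTotallyIsotropic B X) :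
      X ≤ LinearMap.BilinForm.orthogonal B X := fun x hx y hy => hX y hy x hx
  -- Disjointness from `⊥` is no constraint, so `U` is simply a maximal totally isotropic subspace
  -- and $U^\perp\le U$.
  obtain ⟨U, hU, -, hU'⟩ := exists_isTotallyIsotropic_disjoint hB.isAlt (⊥ : Submodule K V)
  rw [sup_bot_eq] at hU'
  obtain ⟨X, hX, hXU, hX'⟩ := exists_isTotallyIsotropic_disjoint hB.isAlt U
  refine ⟨U, X, hU, hX, disjoint_iff.mpr (by rw [inf_comm, hXU]), codisjoint_iff.mpr ?_⟩
  -- A vector of $U\cap X^\perp$ is orthogonal to $X+U\ge X^\perp$, hence lies in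
  -- $X^{\perp\perp}=X$, which is disjoint from `U`.
  have hperp : U ⊓ LinearMap.BilinForm.orthogonal B X = ⊥ := by
    rw [eq_bot_iff, ← hXU]
    refine fun u hu => ⟨?_, hu.1⟩
    rw [← LinearMap.BilinForm.orthogonal_orthogonal hB.nondegenerate hB.isAlt.isRefl X]
    intro w hw
    obtain ⟨x, hx, u', hu', rfl⟩ := Submodule.mem_sup.mp (hX' hw)
    have h1 : B x u = 0 := hu.2 x hx
    have h2 : B u' u = 0 := hU u' hu' u hu.1
    change B (x + u') u = 0
    rw [map_add, LinearMap.add_apply, h1, h2, add_zero]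
  -- From $U^\perp\le U$ comes $\dim U\ge \tfrac12\dim V$, and from $U\cap X^\perp=0$ comes $\dim
  -- U\le\dim X$; with $X\cap U=0$ the sum fills `V`.
  have h1 := LinearMap.BilinForm.finrank_orthogonal hB.nondegenerate U
  have h2 := LinearMap.BilinForm.finrank_orthogonal hB.nondegenerate X
  have h3 := Submodule.finrank_sup_add_finrank_inf_eq U (LinearMap.BilinForm.orthogonal B X)
  have h4 := Submodule.finrank_le (U ⊔ LinearMap.BilinForm.orthogonal B X)
  have h5 := Submodule.finrank_sup_add_finrank_inf_eq X U
  have h6 := Submodule.finrank_le X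
  have h7 := Submodule.finrank_le U
  have h8 := Submodule.finrank_mono hU'
  rw [hperp, finrank_bot] at h3
  rw [hXU, finrank_bot] at h5
  rw [sup_comm]
  apply Submodule.eq_top_of_finrank_eq
  have h9 := Submodule.finrank_le (X ⊔ U)
  omega

/-- A symplectic space is isometric to the standard symplectic space on `M* × M`. -/
theorem IsSymplecticSpace.exists_equiv {d n : ℕ} (hB : IsSymplecticSpace B d) (hd : d = 2 * n)
    (M : Type*) [AddCommGroup M] [Module K M] [Module.Finite K M] (hM : finrank K M = n) :
    ∃ e : (Dual K M × M) ≃ₗ[K] V, ∀ x y, B (e x) (e y) = x.1 y.2 - y.1 x.2 := by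
  have := hB.finite
  obtain ⟨U, X, hU, hX, hUX⟩ := hB.exists_lagrangian_pair
  let β : U →ₗ[K] Dual K X := X.subtype.dualMap ∘ₗ B ∘ₗ U.subtype
  let γ : X →ₗ[K] Dual K U := U.subtype.dualMap ∘ₗ B ∘ₗ X.subtype
  have hβ : Function.Injective β := by
    rw [← LinearMap.ker_eq_bot, LinearMap.ker_eq_bot']
    refine fun u hu => Subtype.ext (hB.nondegenerate.1 _ fun v => ?_)
    obtain ⟨a, ha, x, hx, rfl⟩ := Submodule.mem_sup.mp
      (hUX.sup_eq_top ▸ Submodule.mem_top : v ∈ U ⊔ X)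
    have h1 : B u x = 0 := LinearMap.congr_fun hu ⟨x, hx⟩
    rw [map_add, hU u u.2 a ha, h1, add_zero]
  have hγ : Function.Injective γ := by
    rw [← LinearMap.ker_eq_bot, LinearMap.ker_eq_bot']
    refine fun u hu => Subtype.ext (hB.nondegenerate.1 _ fun v => ?_)
    obtain ⟨a, ha, x, hx, rfl⟩ := Submodule.mem_sup.mp
      (hUX.sup_eq_top ▸ Submodule.mem_top : v ∈ U ⊔ X)
    have h1 : B u a = 0 := LinearMap.congr_fun hu ⟨a, ha⟩
    rw [map_add, hX u u.2 x hx, h1, add_zero]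
  -- Each Lagrangian embeds in the dual of the other, so both have dimension `n`.
  have h1 := LinearMap.finrank_le_finrank_of_injective hβ
  have h2 := LinearMap.finrank_le_finrank_of_injective hγ
  rw [Subspace.dual_finrank_eq] at h1 h2
  have h3 := Submodule.finrank_add_eq_of_isCompl hUX
  rw [hB.finrank_eq] at h3
  let b : U ≃ₗ[K] Dual K X :=
    LinearEquiv.ofInjectiveOfFinrankEq β hβ (by rw [Subspace.dual_finrank_eq]; omega)
  have hb (f : Dual K X) (x : X) : B (b.symm f) x = f x :=
    LinearMap.congr_fun (b.apply_symm_apply f) x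
  let e₁ : M ≃ₗ[K] X := LinearEquiv.ofFinrankEq _ _ (by omega)
  let e : (Dual K M × M) ≃ₗ[K] V := ((e₁.dualMap.symm.trans b.symm).prodCongr e₁).trans
    (Submodule.prodEquivOfIsCompl U X hUX)
  have he (x) : e x = (b.symm (e₁.dualMap.symm x.1) : V) + e₁ x.2 := rfl
  have hpair (f : Dual K M) (y : M) : B (b.symm (e₁.dualMap.symm f)) (e₁ y) = f y := by
    rw [hb]
    exact congrArg f (e₁.symm_apply_apply y)
  refine ⟨e, fun x y => ?_⟩
  rw [he, he, map_add, map_add, LinearMap.add_apply, LinearMap.add_apply, hpair,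
    hU _ (Subtype.mem _) _ (Subtype.mem _), hX _ (Subtype.mem _) _ (Subtype.mem _),
    ← hB.isAlt.neg_eq, hpair]
  ring

/-- Two symplectic spaces of the same dimension are isometric. -/
theorem IsSymplecticSpace.exists_isometry {V' : Type*} [AddCommGroup V'] [Module K V']
    {B' : LinearMap.BilinForm K V'} {n : ℕ} (hB : IsSymplecticSpace B (2 * n))
    (hB' : IsSymplecticSpace B' (2 * n)) :
    ∃ e : V ≃ₗ[K] V', ∀ x y, B' (e x) (e y) = B x y := by
  obtain ⟨e, he⟩ := hB.exists_equiv rfl (Fin n → K) (finrank_fin_fun K)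
  obtain ⟨e', he'⟩ := hB'.exists_equiv rfl (Fin n → K) (finrank_fin_fun K)
  refine ⟨e.symm.trans e', fun x y => ?_⟩
  rw [LinearEquiv.trans_apply, LinearEquiv.trans_apply, he', ← he, e.apply_symm_apply,
    e.apply_symm_apply]

end Symplectic

/-! ### Assembling the theorem -/

section Main

theorem isOrthogonalPlusSpace_dualProd {K M : Type*} [Field K] [AddCommGroup M] [Module K M]
    [Module.Finite K M] :
    IsOrthogonalPlusSpace (QuadraticForm.dualProd K M) (finrank K M) := by
  refine ⟨inferInstance, ?_, nondegenerate_polarBilin_of_separatingLeft ?_,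
    LinearMap.range (LinearMap.inl K (Dual K M) M), ?_, ?_⟩
  · rw [finrank_prod, Subspace.dual_finrank_eq, two_mul]
  · intro x hx
    have hpolar (y) : QuadraticMap.polar (QuadraticForm.dualProd K M) x y =
        x.1 y.2 + y.1 x.2 := by
      simp only [QuadraticMap.polar, QuadraticForm.dualProd_apply, Prod.fst_add, Prod.snd_add,
        LinearMap.add_apply, map_add]
      ring
    simp only [hpolar] at hx
    refine Prod.ext (LinearMap.ext fun y => ?_) ((forall_dual_apply_eq_zero_iff K _).mp fun f => ?_)
    · simpa using hx (0, y)
    · simpa using hx (f, 0)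
  · rintro _ ⟨f, rfl⟩
    simp
  · exact (LinearMap.finrank_range_of_inj LinearMap.inl_injective).trans Subspace.dual_finrank_eq

theorem IsOrthogonalPlusSpace.exists_map_ne_zero {K V : Type*} [Field K] [AddCommGroup V]
    [Module K V] {Q : QuadraticForm K V} {n : ℕ} (hn : n ≠ 0) (hQ : IsOrthogonalPlusSpace Q n) :
    ∃ z, Q z ≠ 0 := by
  by_contra! h
  have : Nontrivial V := nontrivial_of_finrank_pos (R := K) (by rw [hQ.finrank_eq]; omega)
  obtain ⟨x, hx⟩ := exists_ne (0 : V)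
  exact hx (hQ.nondegenerate.1 x fun y => by simp [QuadraticMap.polar, h])

/-- The projection of an orthogonal spread, regarded over a subfield, is maximal. -/
theorem IsOrthogonalSpread.maximal_projectSubspace {E F V : Type*} [Field E] [Finite E]
    [CharP E 2] [Field F] [Algebra E F] [Module.Finite E F] [AddCommGroup V] [Module F V]
    [Module E V] [IsScalarTower E F V] {Q : QuadraticForm F V} {m : ℕ} (hm : 2 ≤ m)
    (hQ : IsOrthogonalPlusSpace Q (2 * m)) {S : Set (Submodule F V)}
    (hS : IsOrthogonalSpread Q S) {z : V} (hz : traceForm E Q z ≠ 0) :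
    Maximal (IsSymplecticPartialSpread (quotientForm (traceForm E Q) z))
      (projectSubspace (traceForm E Q) z '' restrictSpread E S) := by
  have := hQ.finite
  have : Module.Finite E V := Module.Finite.trans F V
  have hpos : 0 < finrank E F := finrank_pos
  refine hS.1.restrictScalars.maximal_projectSubspace hQ.traceForm hz fun Y _ hY => ?_
  -- With $k=[F:E]$, here $\dim_E Y=2mk-1\ge 4k-1>2k$.
  obtain ⟨y, hyY, hy0, hy⟩ := exists_singular_of_two_mul_finrank_lt Q Y (by nlinarith)
  obtain ⟨X, hX, hyX⟩ := hS.2 y hy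
  exact ⟨y, hyY, hy0, _, ⟨X, hX, rfl⟩, hyX⟩

theorem IsOrthogonalSpread.ncard_restrictSpread {E F V : Type*} [Field E] [Finite E] [Field F]
    [Algebra E F] [Module.Finite E F] [AddCommGroup V] [Module F V] [Module E V]
    [IsScalarTower E F V] {Q : QuadraticForm F V} {n : ℕ} (hn : n ≠ 0)
    (hQ : IsOrthogonalPlusSpace Q n) {S : Set (Submodule F V)} (hS : IsOrthogonalSpread Q S) :
    (restrictSpread E S).ncard = Nat.card E ^ (n * finrank E F - finrank E F) + 1 := by
  have : Finite F := Module.finite_of_finite E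
  rw [PartialSpread.ncard_restrictSpread, hS.ncard_eq hn hQ,
    Module.natCard_eq_pow_finrank (K := E) (V := F), ← pow_mul, mul_comm, Nat.sub_mul, one_mul]

end Main

end PartialSpread

open PartialSpread in
theorem mainTheorem4 {E : Type*} [Field E] [Finite E] (q k m : ℕ)
    (hq : Nat.card E = q) (hq_even : Even q) (hk : 1 ≤ k)
    (hm : ((k : ℝ) + 1) / 2 < (m : ℝ)) :
    -- every symplectic `E`-space of dimension `4mk - 2` has a maximal symplectic partial spread
    -- of the stated size
    (∀ (W : Type*) [AddCommGroup W] [Module E W] (B : LinearMap.BilinForm E W),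
      IsSymplecticSpace B (4 * m * k - 2) →
        ∃ T : Set (Submodule E W),
          Maximal (IsSymplecticPartialSpread B) T ∧ T.ncard = q ^ (2 * m * k - k) + 1) ∧
    -- such spreads arise by projection: `F` is the extension of `E` of degree `k` and `(V, Q)`
    -- is an orthogonal `F`-space of plus type and dimension `4m`
    (∀ (F V : Type*) [Field F] [Algebra E F] [AddCommGroup V] [Module F V] [Module E V]
      [IsScalarTower E F V] (Q : QuadraticForm F V),
      Module.finrank E F = k → IsOrthogonalPlusSpace Q (2 * m) →
        (∃ S : Set (Submodule F V), IsOrthogonalSpread Q S) ∧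
        IsOrthogonalPlusSpace (traceForm E Q) (2 * m * k) ∧
        ∀ S : Set (Submodule F V), IsOrthogonalSpread Q S →
          -- the orthogonal partial spread over `E`
          IsOrthogonalPartialSpread (traceForm E Q) (restrictSpread E S) ∧
          Maximal (IsPartialSpread E V) (restrictSpread E S) ∧
          (restrictSpread E S).ncard = q ^ (2 * m * k - k) + 1 ∧
          -- its projection from any nonsingular point
          ∀ z : V, traceForm E Q z ≠ 0 →
            IsSymplecticSpace (quotientForm (traceForm E Q) z) (4 * m * k - 2) ∧
            Maximal (IsSymplecticPartialSpread (quotientForm (traceForm E Q) z))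
              (projectSubspace (traceForm E Q) z '' restrictSpread E S) ∧
            (projectSubspace (traceForm E Q) z '' restrictSpread E S).ncard =
              q ^ (2 * m * k - k) + 1) := by
  -- Since $k\ge 1$, the bound gives $m>1$; the later steps need only $m\ge 2$.
  have hm2 : 2 ≤ m := by
    have hk' : (1 : ℝ) ≤ k := by exact_mod_cast hk
    have : (1 : ℝ) < m := by linarith
    exact_mod_cast this
  have : Fact (Nat.Prime 2) := ⟨Nat.prime_two⟩
  have : CharP E 2 := by
    have := Fintype.ofFinite E
    have h2 : ringChar E = 2 := by
      by_contra h
      have := FiniteField.odd_card_of_char_ne_two h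
      rw [← Nat.card_eq_fintype_card, hq] at this
      rw [Nat.even_iff] at hq_even
      omega
    exact ringChar.of_eq h2
  have hmk : 2 ≤ 2 * m * k := by nlinarith
  have h4 : 4 * m * k = 2 * (2 * m * k) := by ring
  refine ⟨fun W _ _ B hB => ?_, fun F V _ _ _ _ _ _ Q hF hQ => ?_⟩
  · have : NeZero k := ⟨by omega⟩
    let F := FiniteField.Extension E 2 k
    have hF : Module.finrank E F = k := FiniteField.finrank_extension E 2 k
    have : CharP F 2 := charP_of_injective_algebraMap (algebraMap E F).injective 2
    have : Finite F := Module.finite_of_finite E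
    -- For (a), any one orthogonal $F$-space serves as a model; its projected spread is carried to
    -- the given space by an isometry.
    have hQ : IsOrthogonalPlusSpace (QuadraticForm.dualProd F (Fin (2 * m) → F)) (2 * m) := by
      simpa using isOrthogonalPlusSpace_dualProd (K := F) (M := Fin (2 * m) → F)
    obtain ⟨S, hS⟩ := hQ.exists_isOrthogonalSpread (by omega)
    have hQ' := hQ.traceForm (E := E)
    have hcard := hS.ncard_restrictSpread (E := E) (by omega) hQ
    rw [hF] at hQ' hcard
    obtain ⟨z, hz⟩ := hQ'.exists_map_ne_zero (by omega)
    rw [h4, ← Nat.mul_sub_one] at hB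
    have hsymp := hQ'.isSymplecticSpace_quotientForm (ne_zero_of_map_ne_zero hz)
    rw [← Nat.mul_sub_one] at hsymp
    obtain ⟨e, he⟩ := hsymp.exists_isometry hB
    refine ⟨_, maximal_isSymplecticPartialSpread_map (hS.maximal_projectSubspace hm2 hQ hz) e he, ?_⟩
    rw [ncard_image_map_equiv, hS.1.restrictScalars.ncard_projectSubspace hmk hQ' hz, hcard, hq]
  · have : Module.Finite E F := Module.finite_of_finrank_pos (by omega)
    have : Finite F := Module.finite_of_finite E
    have : CharP F 2 := charP_of_injective_algebraMap (algebraMap E F).injective 2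
    have := hQ.finite
    have hQ' : IsOrthogonalPlusSpace (traceForm E Q) (2 * m * k) := hF ▸ hQ.traceForm
    refine ⟨hQ.exists_isOrthogonalSpread (by omega), hQ', fun S hS => ?_⟩
    have hcard := hS.ncard_restrictSpread (E := E) (by omega) hQ
    rw [hF, hq] at hcard
    refine
      ⟨hS.1.restrictScalars, hS.maximal_restrictSpread (by rw [hQ.finrank_eq]; omega),
        hcard, fun z hz => ⟨?_, hS.maximal_projectSubspace hm2 hQ hz, ?_⟩⟩
    · rw [h4]
      exact hQ'.isSymplecticSpace_quotientForm (ne_zero_of_map_ne_zero hz)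
    · rw [hS.1.restrictScalars.ncard_projectSubspace hmk hQ' hz, hcard]
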